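/- For $n\ge 1$ let $h_n=\sum_{j=1}^n 1/j$ and let $H_n$ be the Harmonic$(n)$ distribution on $\{1,\dots,n\}$, i.e. $H_n(i)=\frac{1}{i\,h_n}$ for $1\le i\le n$. Put $\varepsilon_{i,n}=H_n(i)-\frac1n$ for $1\le i\le n$. Then $(H_n)$ is a sequence of E-K distributions with constants $C=D=1$; that is, each $H_n$ is a probability distribution on $\{1,\dots,n\}$, and the following three constraints hold. 1. For all integers $n>1$ and all primes $p>n^{1/\log\log n}$, $$\sum_{l=1}^{\lfloor n/p\rfloor}\varepsilon_{lp,n}\le\frac{C}{p}=\frac1p .$$ 2. For all integers $n>1$, all $k$, and all $k$-tuples $(p_1,\dots,p_k)$ of distinct primes with $p_j\le n^{1/\log\log n}$ for every $j$, $$\sum_{l=1}^{\lfloor n/(p_1\cdots p_k)\rfloor}\varepsilon_{lp_1\cdots p_k,n}\le\frac{D}{n}=\frac1n .$$ 3. For every prime $p$, $\displaystyle\lim_{n\to\infty}\sum_{l=1}^{\lfloor n/p\rfloor}\varepsilon_{lp,n}=0$. Moreover, writing $\omega(m)$ for the number of distinct prime factors of $m$, the number $\omega(m)$ for an $H_n$-distributed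 integer $m$ is asymptotically normal with mean and variance $\log\log n$: for every $x\in\mathbb{R}$, as $n\to\infty$, $$H_n\bigl(m\le n:\ \omega(m)-\log\log n\le x(\log\log n)^{1/2}\bigr)\to\mathbb{P}(Z\le x),$$ where $Z$ is a standard normal random variable. -/

import Mathlib

/-- The harmonic number `h_n = ∑_{j=1}^n 1/j`, as a real number. -/
noncomputable def harmonicNumber (n : ℕ+) : ℝ := ((harmonic (n : ℕ) : ℚ) : ℝ)

theorem harmonicNumber_eq_sum (n : ℕ+) :
    harmonicNumber n = ∑ j ∈ Finset.Icc 1 (n : ℕ), 1 / (j : ℝ) := by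
  simp [harmonicNumber, harmonic_eq_sum_Icc]

theorem harmonicNumber_pos (n : ℕ+) : 0 < harmonicNumber n :=
  Rat.cast_pos.2 (harmonic_pos n.ne_zero)

theorem sum_harmonicWeight (n : ℕ+) :
    ∑ i ∈ Finset.Icc 1 (n : ℕ),
      (if i ∈ Finset.Icc 1 (n : ℕ) then
        ENNReal.ofReal (1 / ((i : ℝ) * harmonicNumber n)) else 0) = 1 := by
  have h := harmonicNumber_pos n
  rw [Finset.sum_congr rfl (fun i hi => if_pos hi),
    ← ENNReal.ofReal_sum_of_nonneg (fun i _ => by positivity), ENNReal.ofReal_eq_one]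
  have h2 : ∀ i ∈ Finset.Icc 1 (n : ℕ),
      1 / ((i : ℝ) * harmonicNumber n) = 1 / (i : ℝ) * (1 / harmonicNumber n) :=
    fun i _ => (one_div_mul_one_div _ _).symm
  rw [Finset.sum_congr rfl h2, ← Finset.sum_mul]
  rw [← harmonicNumber_eq_sum]
  exact mul_one_div_cancel h.ne'

/-- The `Harmonic(n)` distribution on `{1, …, n}`, viewed as a distribution on `ℕ`:
the probability of `i` is `1 / (i * h_n)` for `1 ≤ i ≤ n`, and `0` for every other `i`. -/
noncomputable def harmonicPMF (n : ℕ+) : PMF ℕ :=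
  PMF.ofFinset
    (fun i => if i ∈ Finset.Icc 1 (n : ℕ) then
      ENNReal.ofReal (1 / ((i : ℝ) * harmonicNumber n)) else 0)
    (Finset.Icc 1 (n : ℕ)) (sum_harmonicWeight n) (fun _ hi => if_neg hi)

/-- The deviation `ε_{i,n} = P_n(i) - 1/n` of the probability of `i` under `P_n` from the
probability under the uniform distribution on `{1, …, n}`. -/
noncomputable def deviation (P : ℕ+ → PMF ℕ) (i : ℕ) (n : ℕ+) : ℝ :=
  (P n i).toReal - 1 / (n : ℝ)

/-- The threshold `α_n = n ^ (1 / log log n)`; used for `n > 1` only, where `log log n ≠ 0`. -/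
noncomputable def primeThreshold (n : ℕ+) : ℝ :=
  (n : ℝ) ^ (1 / Real.log (Real.log (n : ℝ)))

/-- `P_n` (`n ≥ 1`) is a sequence of E-K distributions with constants `C` and `D`: each `P_n` is a
probability distribution on `{1, …, n}`, and the deviations `ε_{i,n}` satisfy the three constraints
on their sums along multiples of primes and of products of distinct primes. The natural-number
quotients are the floors `⌊n / p⌋` and `⌊n / (p_1 ⋯ p_k)⌋`. -/
structure IsEKDistribution (P : ℕ+ → PMF ℕ) (C D : ℝ) : Prop where
  support_subset : ∀ n : ℕ+, (P n).support ⊆ Set.Icc 1 (n : ℕ)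
  large_primes : ∀ n : ℕ+, 1 < n → ∀ p : ℕ, p.Prime → primeThreshold n < (p : ℝ) →
    ∑ l ∈ Finset.Icc 1 ((n : ℕ) / p), deviation P (l * p) n ≤ C / (p : ℝ)
  small_primes : ∀ n : ℕ+, 1 < n → ∀ (k : ℕ) (p : Fin k → ℕ), Function.Injective p →
    (∀ j, (p j).Prime) → (∀ j, (p j : ℝ) ≤ primeThreshold n) →
    ∑ l ∈ Finset.Icc 1 ((n : ℕ) / ∏ j, p j), deviation P (l * ∏ j, p j) n ≤ D / (n : ℝ)
  tendsto_zero : ∀ p : ℕ, p.Prime →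
    Filter.Tendsto (fun n : ℕ+ => ∑ l ∈ Finset.Icc 1 ((n : ℕ) / p), deviation P (l * p) n)
      Filter.atTop (nhds 0)

/-! Write h_n for the harmonic numbers. The three constraints rest on one computation
(`sum_deviation_harmonicPMF`): the deviations along the multiples of d sum to h_{⌊n/d⌋}/(d h_n) -
⌊n/d⌋/n, where h_{⌊n/d⌋}/h_n is at most 1 and tends to 1.

The limit law is first proved for zeta weights m^(-s), s = 1 + l/x. The Euler product gives ∑ z^ω(m)
m^(-s) = ζ(s) ∏ (1 + (z-1) p^(-s)) = ζ(s) exp((z-1) log ζ(s) + O(|z-1|)). For z = exp(it/√(log x)),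
centring and dividing by x leaves exp(-t²/2)/l in the limit (`tendsto_zeta_charFun`).

Karamata's method then replaces the zeta weights by 1/m for m ≤ N. With x = log N and u = m^(-1/x),
the cases l = k+1 say that the k-th moments of u, twisted by the characters, tend to exp(-t²/2) ∫
u^k over [0,1]. Weierstrass approximation extends this to continuous functions of u, and a squeeze
to 1/u cut off below 1/e, which selects exactly m ≤ N (`tendsto_tsum_cutoff`). The characters vary
with N but have modulus 1, so the positive weights alone control the errors. The case t = 0 gives
h_N ~ log N, and Lévy's continuity theorem concludes. -/

open Filter Topology

/-! ### Karamata's method: from moments to a sharp cutoff -/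

/-- The sum of the bounded coefficients `F` against the weights `W` and a kernel `g` evaluated at
the points `u`. -/
noncomputable def kernelSum (F : ℕ → ℂ) (W u : ℕ → ℝ) (g : ℝ → ℝ) : ℂ :=
  ∑' m, F m * ((W m * g (u m) : ℝ) : ℂ)

/-- The abstract squeeze step of Karamata's method: weighted sums of `G ∘ u` converge as soon as
`G` can be approximated, up to an error dominated by a function of small limit, by functions for
which the weighted sums converge. -/
theorem tendsto_tsum_of_dominated_approx {F : ℕ → ℕ → ℂ} {W u : ℕ → ℕ → ℝ} {c : ℂ} {G : ℝ → ℝ}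
    {I : ℝ} (hF : ∀ N m, ‖F N m‖ ≤ 1) (hW : ∀ N m, 0 ≤ W N m)
    (hu : ∀ N m, u N m ∈ Set.Icc (0 : ℝ) 1)
    (hG : ∀ N, Summable fun m => F N m * ((W N m * G (u N m) : ℝ) : ℂ))
    (happ : ∀ ε > 0, ∃ (g h : ℝ → ℝ) (J H : ℝ),
      (∀ N, Summable fun m => F N m * ((W N m * g (u N m) : ℝ) : ℂ)) ∧
      (∀ N, Summable fun m => W N m * h (u N m)) ∧
      Tendsto (fun N => kernelSum (F N) (W N) (u N) g) atTop (𝓝 (c * J)) ∧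
      Tendsto (fun N => ∑' m, W N m * h (u N m)) atTop (𝓝 H) ∧
      |J - I| ≤ ε ∧ H ≤ ε ∧ ∀ x ∈ Set.Icc (0 : ℝ) 1, |G x - g x| ≤ h x) :
    Tendsto (fun N => kernelSum (F N) (W N) (u N) G) atTop (𝓝 (c * I)) := by
  rw [Metric.tendsto_atTop']
  intro η hη
  -- The three errors are below 2ε, below ε and at most ‖c‖ε, so they add up to less than η.
  set ε := η / (4 + ‖c‖) with hε
  have hc := norm_nonneg c
  have hεpos : 0 < ε := by positivity
  obtain ⟨g, h, J, H, hg, hh, hgt, hht, hJ, hH, hGg⟩ := happ ε hεpos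
  have e1 : ∀ᶠ N in atTop, ‖kernelSum (F N) (W N) (u N) g - c * J‖ < ε := by
    filter_upwards [hgt.eventually (Metric.ball_mem_nhds _ hεpos)] with N hN
    simpa [dist_eq_norm] using hN
  have e2 : ∀ᶠ N in atTop, ∑' m, W N m * h (u N m) < 2 * ε :=
    hht.eventually (gt_mem_nhds (by linarith))
  obtain ⟨N₀, hN₀⟩ := eventually_atTop.1 (e1.and e2)
  refine ⟨N₀, fun N hN => ?_⟩
  obtain ⟨h1, h2⟩ := hN₀ N hN.le
  rw [dist_eq_norm]
  have key : ‖kernelSum (F N) (W N) (u N) G -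
      kernelSum (F N) (W N) (u N) g‖ ≤ ∑' m, W N m * h (u N m) := by
    rw [kernelSum, kernelSum, ← (hG N).tsum_sub (hg N)]
    refine tsum_of_norm_bounded (hh N).hasSum fun m => ?_
    rw [← mul_sub, ← Complex.ofReal_sub, ← mul_sub, norm_mul, Complex.norm_real, norm_mul,
      Real.norm_of_nonneg (hW N m), Real.norm_eq_abs]
    calc _ ≤ 1 * (W N m * h (u N m)) := by
          gcongr
          · exact mul_nonneg (hW N m) (abs_nonneg _)
          · exact hF N m
          · exact hW N m
          · exact hGg _ (hu N m)
      _ = _ := one_mul _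
  have h3 : ‖c * J - c * I‖ ≤ ‖c‖ * ε := by
    rw [← mul_sub, norm_mul, ← Complex.ofReal_sub, Complex.norm_real]
    gcongr
    exact hJ
  have h4 : η = ε * (4 + ‖c‖) := by rw [hε]; field_simp
  calc _ ≤ ‖kernelSum (F N) (W N) (u N) G -
        kernelSum (F N) (W N) (u N) g‖ +
        ‖kernelSum (F N) (W N) (u N) g - c * J‖ + ‖c * J - c * I‖ := by
        refine le_trans (le_of_eq ?_) ((norm_add_le _ _).trans
          (add_le_add_left (norm_add_le _ _) _))
        congr 1; ring
    _ < η := by rw [h4]; nlinarith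

theorem summable_mul_weight_of_bounded {F : ℕ → ℂ} {W u : ℕ → ℝ} {g : ℝ → ℝ} {B : ℝ}
    (hF : ∀ m, ‖F m‖ ≤ 1) (hW : ∀ m, 0 ≤ W m) (hsum : Summable W)
    (hu : ∀ m, u m ∈ Set.Icc (0 : ℝ) 1) (hg : ∀ x ∈ Set.Icc (0 : ℝ) 1, |g x| ≤ B) :
    Summable fun m => F m * ((W m * g (u m) : ℝ) : ℂ) := by
  refine Summable.of_norm_bounded (hsum.mul_right B) fun m => ?_
  rw [norm_mul, Complex.norm_real, norm_mul, Real.norm_of_nonneg (hW m), Real.norm_eq_abs]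
  calc _ ≤ 1 * (W m * B) := by
        gcongr
        · exact mul_nonneg (hW m) (abs_nonneg _)
        · exact hF m
        · exact hW m
        · exact hg _ (hu m)
    _ = _ := one_mul _

theorem ContinuousOn.exists_abs_le_Icc {g : ℝ → ℝ} (hg : ContinuousOn g (Set.Icc (0 : ℝ) 1)) :
    ∃ B, ∀ x ∈ Set.Icc (0 : ℝ) 1, |g x| ≤ B :=
  isCompact_Icc.exists_bound_of_continuousOn hg

theorem tendsto_tsum_polynomial {F : ℕ → ℕ → ℂ} {W u : ℕ → ℕ → ℝ} {c : ℂ}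
    (hF : ∀ N m, ‖F N m‖ ≤ 1) (hW : ∀ N m, 0 ≤ W N m) (hsum : ∀ N, Summable (W N))
    (hu : ∀ N m, u N m ∈ Set.Icc (0 : ℝ) 1)
    (hmom : ∀ k : ℕ, Tendsto (fun N => kernelSum (F N) (W N) (u N) (· ^ k)) atTop
      (𝓝 (c * (1 / (k + 1) : ℝ)))) (P : Polynomial ℝ) :
    Tendsto (fun N => kernelSum (F N) (W N) (u N) fun x => P.eval x) atTop
      (𝓝 (c * (∫ x in (0 : ℝ)..1, P.eval x : ℝ))) := by
  induction P using Polynomial.induction_on' with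
  | add P Q hP hQ =>
    have hs : ∀ (R : Polynomial ℝ) N,
        Summable fun m => F N m * ((W N m * R.eval (u N m) : ℝ) : ℂ) := by
      intro R N
      obtain ⟨B, hB⟩ := R.continuous.continuousOn.exists_abs_le_Icc
      exact summable_mul_weight_of_bounded (g := fun x => R.eval x) (hF N) (hW N) (hsum N) (hu N) hB
    have hint : ∫ x in (0 : ℝ)..1, (P + Q).eval x =
        (∫ x in (0 : ℝ)..1, P.eval x) + ∫ x in (0 : ℝ)..1, Q.eval x := by
      simp only [Polynomial.eval_add]
      exact intervalIntegral.integral_add (P.continuous.intervalIntegrable _ _)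
        (Q.continuous.intervalIntegrable _ _)
    rw [hint, Complex.ofReal_add, mul_add]
    refine (hP.add hQ).congr fun N => ?_
    rw [kernelSum, kernelSum, kernelSum, ← (hs P N).tsum_add (hs Q N)]
    refine tsum_congr fun m => ?_
    rw [Polynomial.eval_add, mul_add, Complex.ofReal_add, mul_add]
  | monomial k a =>
    have hint : ∫ x in (0 : ℝ)..1, (Polynomial.monomial k a).eval x = a * (1 / (k + 1)) := by
      simp only [Polynomial.eval_monomial]
      rw [intervalIntegral.integral_const_mul, integral_pow]
      simp
    rw [hint, Complex.ofReal_mul, mul_left_comm]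
    refine ((hmom k).const_mul (a : ℂ)).congr fun N => ?_
    rw [kernelSum, kernelSum, ← tsum_mul_left]
    refine tsum_congr fun m => ?_
    rw [Polynomial.eval_monomial, ← mul_assoc, mul_comm (a : ℂ), mul_assoc, ← Complex.ofReal_mul]
    congr 2
    ring

theorem tendsto_tsum_of_tendsto_ofReal {W : ℕ → ℕ → ℝ} {a : ℝ}
    (h : Tendsto (fun N => ∑' m, ((W N m : ℝ) : ℂ)) atTop (𝓝 (a : ℂ))) :
    Tendsto (fun N => ∑' m, W N m) atTop (𝓝 a) := by
  simp only [← Complex.ofReal_tsum] at h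
  exact (Complex.continuous_re.tendsto _).comp h

/-- Weierstrass approximation: the majorant of the error is the constant ε, whose weighted sum tends
to ε because the total mass tends to 1. -/
theorem tendsto_tsum_continuous {F : ℕ → ℕ → ℂ} {W u : ℕ → ℕ → ℝ} {c : ℂ}
    (hF : ∀ N m, ‖F N m‖ ≤ 1) (hW : ∀ N m, 0 ≤ W N m) (hsum : ∀ N, Summable (W N))
    (hu : ∀ N m, u N m ∈ Set.Icc (0 : ℝ) 1)
    (hW0 : Tendsto (fun N => ∑' m, W N m) atTop (𝓝 1))
    (hmom : ∀ k : ℕ, Tendsto (fun N => kernelSum (F N) (W N) (u N) (· ^ k)) atTop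
      (𝓝 (c * (1 / (k + 1) : ℝ)))) {g : ℝ → ℝ} (hg : Continuous g) :
    Tendsto (fun N => kernelSum (F N) (W N) (u N) g) atTop
      (𝓝 (c * (∫ x in (0 : ℝ)..1, g x : ℝ))) := by
  have hs : ∀ {g : ℝ → ℝ}, Continuous g → ∀ N,
      Summable fun m => F N m * ((W N m * g (u N m) : ℝ) : ℂ) := by
    intro g hg N
    obtain ⟨B, hB⟩ := hg.continuousOn.exists_abs_le_Icc
    exact summable_mul_weight_of_bounded (g := g) (hF N) (hW N) (hsum N) (hu N) hB
  refine tendsto_tsum_of_dominated_approx (G := g) hF hW hu (hs hg) fun ε hε => ?_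
  obtain ⟨P, hP⟩ := exists_polynomial_near_of_continuousOn 0 1 g hg.continuousOn ε hε
  refine ⟨fun x => P.eval x, fun _ => ε, ∫ x in (0 : ℝ)..1, P.eval x, ε,
    hs (g := fun x => P.eval x) P.continuous,
    fun N => (hsum N).mul_right ε, tendsto_tsum_polynomial hF hW hsum hu hmom P, ?_, ?_, le_rfl,
    fun x hx => ?_⟩
  · simpa [tsum_mul_right] using hW0.mul_const ε
  · rw [← intervalIntegral.integral_sub (P.continuous.intervalIntegrable _ _)
      (hg.intervalIntegrable _ _)]
    have := intervalIntegral.norm_integral_le_of_norm_le_const (a := (0 : ℝ)) (b := 1)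
      (f := fun x => P.eval x - g x) (C := ε) (fun x hx => by
        rw [Set.uIoc_of_le zero_le_one] at hx
        exact (hP x ⟨hx.1.le, hx.2⟩).le)
    simpa using this
  · rw [abs_sub_comm]
    exact (hP x hx).le

/-- A continuous ramp of width `δ`, equal to `0` below `a` and to `1` above `a + δ`. -/
noncomputable def ramp (a δ x : ℝ) : ℝ := max 0 (min 1 ((x - a) / δ))

theorem continuous_ramp (a δ : ℝ) : Continuous (ramp a δ) := by
  unfold ramp; fun_prop

theorem ramp_nonneg (a δ x : ℝ) : 0 ≤ ramp a δ x := le_max_left _ _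

theorem ramp_le_one (a δ x : ℝ) : ramp a δ x ≤ 1 := max_le zero_le_one (min_le_left _ _)

theorem ramp_eq_zero {a δ x : ℝ} (hδ : 0 < δ) (hx : x ≤ a) : ramp a δ x = 0 :=
  max_eq_left ((min_le_right _ _).trans (div_nonpos_of_nonpos_of_nonneg (by linarith) hδ.le))

theorem ramp_eq_one {a δ x : ℝ} (hδ : 0 < δ) (hx : a + δ ≤ x) : ramp a δ x = 1 := by
  rw [ramp, min_eq_left, max_eq_right zero_le_one]
  rw [le_div_iff₀ hδ]; linarith

/-- The integral over `[0,1]` of a function with values in `[0,B]` which vanishes off an interval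
of length `2δ` is at most `2δB`. -/
theorem integral_le_of_support_subset {g : ℝ → ℝ} (hg : Continuous g) {a δ B : ℝ} (hδ : 0 < δ)
    (ha : 0 ≤ a - δ) (ha' : a + δ ≤ 1)
    (hB : ∀ x, g x ≤ B) (h0 : ∀ x, x ≤ a - δ → g x = 0) (h1 : ∀ x, a + δ ≤ x → g x = 0) :
    ∫ x in (0 : ℝ)..1, g x ≤ 2 * δ * B := by
  have hi : ∀ p q : ℝ, IntervalIntegrable g MeasureTheory.volume p q :=
    fun p q => hg.intervalIntegrable p q
  rw [← intervalIntegral.integral_add_adjacent_intervals (hi 0 (a - δ)) (hi _ 1),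
    ← intervalIntegral.integral_add_adjacent_intervals (hi (a - δ) (a + δ)) (hi _ 1)]
  have z1 : ∫ x in (0 : ℝ)..(a - δ), g x = 0 :=
    intervalIntegral.integral_zero_ae (.of_forall fun x hx => by
      rw [Set.uIoc_of_le ha] at hx; exact h0 x hx.2)
  have z2 : ∫ x in (a + δ)..1, g x = 0 :=
    intervalIntegral.integral_zero_ae (.of_forall fun x hx => by
      rw [Set.uIoc_of_le ha'] at hx; exact h1 x hx.1.le)
  have z3 : ∫ x in (a - δ)..(a + δ), g x ≤ ∫ x in (a - δ)..(a + δ), B :=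
    intervalIntegral.integral_mono_on (by linarith) (hi _ _) (by simp) fun x _ => hB x
  rw [intervalIntegral.integral_const] at z3
  rw [z1, z2]
  simp only [smul_eq_mul] at z3
  linarith

/-- The kernel `x ↦ 1/x` cut off below `a`, which extracts a sharp cutoff in Karamata's method. -/
theorem tendsto_tsum_cutoff {F : ℕ → ℕ → ℂ} {W u : ℕ → ℕ → ℝ} {c : ℂ} {a : ℝ} (ha : 0 < a)
    (ha1 : a < 1)
    (hF : ∀ N m, ‖F N m‖ ≤ 1) (hW : ∀ N m, 0 ≤ W N m) (hsum : ∀ N, Summable (W N))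
    (hu : ∀ N m, u N m ∈ Set.Icc (0 : ℝ) 1)
    (hmom1 : ∀ k : ℕ, Tendsto (fun N => ∑' m, W N m * u N m ^ k) atTop
      (𝓝 (1 / (k + 1) : ℝ)))
    (hmom : ∀ k : ℕ, Tendsto (fun N => kernelSum (F N) (W N) (u N) (· ^ k)) atTop
      (𝓝 (c * (1 / (k + 1) : ℝ)))) :
    Tendsto (fun N => kernelSum (F N) (W N) (u N) fun x => if a ≤ x then x⁻¹ else 0)
      atTop (𝓝 (c * (-Real.log a : ℝ))) := by
  have hW0 : Tendsto (fun N => ∑' m, W N m) atTop (𝓝 1) := by simpa using hmom1 0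
  have hs : ∀ {g : ℝ → ℝ}, Continuous g → ∀ N,
      Summable fun m => F N m * ((W N m * g (u N m) : ℝ) : ℂ) := by
    intro g hg N
    obtain ⟨B, hB⟩ := hg.continuousOn.exists_abs_le_Icc
    exact summable_mul_weight_of_bounded (g := g) (hF N) (hW N) (hsum N) (hu N) hB
  have hreal : ∀ {g : ℝ → ℝ}, Continuous g →
      Tendsto (fun N => ∑' m, W N m * g (u N m)) atTop (𝓝 (∫ x in (0 : ℝ)..1, g x)) := by
    intro g hg
    apply tendsto_tsum_of_tendsto_ofReal
    have := tendsto_tsum_continuous (F := fun _ _ => 1) (c := 1) (g := g) (by simp) hW hsum hu hW0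
      (fun k => by
        rw [one_mul]
        refine ((Complex.continuous_ofReal.tendsto _).comp (hmom1 k)).congr fun N => ?_
        simp only [Function.comp_def, Complex.ofReal_tsum, kernelSum, one_mul]) hg
    simpa only [kernelSum, one_mul] using this
  refine tendsto_tsum_of_dominated_approx (G := fun x => if a ≤ x then x⁻¹ else 0) hF hW hu
    (fun N => summable_mul_weight_of_bounded
      (g := fun x => if a ≤ x then x⁻¹ else 0) (B := a⁻¹) (hF N) (hW N) (hsum N) (hu N) ?_)
    fun ε hε => ?_
  · intro x _
    split_ifs with h
    · rw [abs_of_nonneg (inv_nonneg.2 (ha.le.trans h))]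
      gcongr
    · simpa using ha.le
  -- The first two bounds keep [a-δ, a+δ] inside [0,1]; the third makes the integral 2δ/a of the
  -- majorant at most ε.
  set δ := min (min (a / 2) ((1 - a) / 2)) (ε * a / 4) with hδdef
  have hδ : 0 < δ := by
    refine lt_min (lt_min (by linarith) (by linarith)) (by positivity)
  have hδa : δ ≤ a / 2 := (min_le_left _ _).trans (min_le_left _ _)
  have hδ1 : δ ≤ (1 - a) / 2 := (min_le_left _ _).trans (min_le_right _ _)
  have hδε : δ ≤ ε * a / 4 := min_le_right _ _
  have hmax : ∀ x, 0 < max x a := fun x => ha.trans_le (le_max_right _ _)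
  have hcinv : Continuous fun x : ℝ => (max x a)⁻¹ :=
    (continuous_id.max continuous_const).inv₀ fun x => (hmax x).ne'
  -- The ramp vanishes for x ≤ a, so the `max` only removes the singularity at 0. The majorant in
  -- `hh` is a difference of two ramps, supported on [a-δ, a+δ] and scaled by the largest value 1/a
  -- of the kernel.
  have hg : Continuous fun x : ℝ => (max x a)⁻¹ * ramp a δ x := hcinv.mul (continuous_ramp _ _)
  have hh : Continuous fun x : ℝ => a⁻¹ * (ramp (a - δ) δ x - ramp a δ x) :=
    continuous_const.mul ((continuous_ramp _ _).sub (continuous_ramp _ _))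
  have hmon : ∀ x, ramp a δ x ≤ ramp (a - δ) δ x := fun x => by
    unfold ramp; gcongr; linarith
  have hHle : ∫ x in (0 : ℝ)..1, a⁻¹ * (ramp (a - δ) δ x - ramp a δ x) ≤ ε := by
    refine (integral_le_of_support_subset hh (a := a) (δ := δ) (B := a⁻¹) hδ (by linarith)
      (by linarith) (fun x => ?_) (fun x hx => ?_) (fun x hx => ?_)).trans ?_
    · have h1 := ramp_le_one (a - δ) δ x
      have h2 := ramp_nonneg a δ x
      have : ramp (a - δ) δ x - ramp a δ x ≤ 1 := by linarith
      exact mul_le_of_le_one_right (inv_nonneg.2 ha.le) this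
    · rw [ramp_eq_zero hδ hx, ramp_eq_zero hδ (by linarith)]; simp
    · rw [ramp_eq_one hδ hx, ramp_eq_one hδ (by linarith)]; simp
    · rw [← div_eq_mul_inv, div_le_iff₀ ha]; nlinarith
  have hpt : ∀ x, |(if a ≤ x then x⁻¹ else 0) - (max x a)⁻¹ * ramp a δ x| ≤
      a⁻¹ * (ramp (a - δ) δ x - ramp a δ x) := by
    intro x
    split_ifs with h
    · rw [max_eq_left h, ramp_eq_one (a := a - δ) hδ (by linarith)]
      have h2 := ramp_le_one a δ x
      have h3 : 0 < x⁻¹ := inv_pos.2 (ha.trans_le h)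
      have h4 : x⁻¹ ≤ a⁻¹ := by gcongr
      rw [show x⁻¹ - x⁻¹ * ramp a δ x = x⁻¹ * (1 - ramp a δ x) by ring,
        abs_of_nonneg (mul_nonneg h3.le (by linarith))]
      exact mul_le_mul_of_nonneg_right h4 (by linarith)
    · rw [ramp_eq_zero hδ (not_le.1 h).le]
      simpa using mul_nonneg (inv_nonneg.2 ha.le) (ramp_nonneg (a - δ) δ x)
  refine ⟨fun x : ℝ => (max x a)⁻¹ * ramp a δ x,
    fun x : ℝ => a⁻¹ * (ramp (a - δ) δ x - ramp a δ x), _, _,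
    hs (g := fun x : ℝ => (max x a)⁻¹ * ramp a δ x) hg, fun N => ?_,
    tendsto_tsum_continuous (g := fun x : ℝ => (max x a)⁻¹ * ramp a δ x) hF hW hsum hu hW0 hmom hg,
    hreal (g := fun x : ℝ => a⁻¹ * (ramp (a - δ) δ x - ramp a δ x)) hh, ?_, hHle, fun x _ => hpt x⟩
  · have := summable_mul_weight_of_bounded (F := fun _ => 1)
      (g := fun x : ℝ => a⁻¹ * (ramp (a - δ) δ x - ramp a δ x)) (by simp) (hW N) (hsum N) (hu N)
      hh.continuousOn.exists_abs_le_Icc.choose_spec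
    simpa only [one_mul, Complex.summable_ofReal] using this
  · have hI : ∫ x in a..1, (max x a)⁻¹ = -Real.log a := by
      rw [intervalIntegral.integral_congr (g := fun x => x⁻¹), integral_inv_of_pos ha one_pos,
        one_div, Real.log_inv]
      intro x hx
      rw [Set.uIcc_of_le ha1.le] at hx
      simp only [max_eq_left hx.1]
    have h0 : ∫ x in (0 : ℝ)..a, (max x a)⁻¹ * ramp a δ x = 0 :=
      intervalIntegral.integral_zero_ae (.of_forall fun x hx => by
        rw [Set.uIoc_of_le ha.le] at hx
        rw [ramp_eq_zero hδ hx.2, mul_zero])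
    have h0' : 0 ≤ ∫ x in (0 : ℝ)..a, a⁻¹ * (ramp (a - δ) δ x - ramp a δ x) :=
      intervalIntegral.integral_nonneg ha.le fun x _ =>
        mul_nonneg (inv_nonneg.2 ha.le) (sub_nonneg.2 (hmon x))
    have hsplit := intervalIntegral.integral_add_adjacent_intervals
      (hh.intervalIntegrable (μ := MeasureTheory.volume) 0 a) (hh.intervalIntegrable a 1)
    rw [← intervalIntegral.integral_add_adjacent_intervals (hg.intervalIntegrable 0 a)
      (hg.intervalIntegrable a 1), h0, zero_add, ← hI, ← intervalIntegral.integral_sub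
      (hg.intervalIntegrable a 1) (hcinv.intervalIntegrable a 1)]
    -- The pointwise bound `hpt`, integrated over [a,1], bounds |J - I| by the same integral of the
    -- majorant.
    refine (intervalIntegral.abs_integral_le_integral_abs ha1.le).trans
      (le_trans (intervalIntegral.integral_mono_on ha1.le
        ((hg.sub hcinv).abs.intervalIntegrable _ _) (hh.intervalIntegrable a 1) fun x hx => ?_)
        (by linarith))
    have := hpt x
    rw [if_pos hx.1, abs_sub_comm] at this
    simpa only [max_eq_left hx.1] using this

/-! ### The Euler product of z^ω and the prime zeta function -/

open ArithmeticFunction in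
/-- The multiplicative function `m ↦ z ^ ω(m) * m ^ (-(1 + δ))`. -/
noncomputable def omegaTerm (z : ℂ) (δ : ℝ) (m : ℕ) : ℂ :=
  z ^ cardDistinctFactors m * (((m : ℝ) ^ (-(1 + δ)) : ℝ) : ℂ)

theorem omegaTerm_one_right (z : ℂ) (δ : ℝ) : omegaTerm z δ 1 = 1 := by simp [omegaTerm]

theorem omegaTerm_zero_right (z : ℂ) {δ : ℝ} (hδ : 0 < δ) : omegaTerm z δ 0 = 0 := by
  rw [omegaTerm, Nat.cast_zero, Real.zero_rpow (by linarith), Complex.ofReal_zero, mul_zero]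

theorem omegaTerm_mul (z : ℂ) (δ : ℝ) {m n : ℕ} (h : m.Coprime n) :
    omegaTerm z δ (m * n) = omegaTerm z δ m * omegaTerm z δ n := by
  simp only [omegaTerm]
  rw [ArithmeticFunction.cardDistinctFactors_mul h, pow_add, Nat.cast_mul,
    Real.mul_rpow (Nat.cast_nonneg _) (Nat.cast_nonneg _)]
  push_cast
  ring

theorem summable_rpow_neg_one_add {δ : ℝ} (hδ : 0 < δ) :
    Summable fun m : ℕ => (m : ℝ) ^ (-(1 + δ)) :=
  Real.summable_nat_rpow.2 (by linarith)

theorem norm_omegaTerm_le {z : ℂ} (hz : ‖z‖ ≤ 1) (δ : ℝ) (m : ℕ) :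
    ‖omegaTerm z δ m‖ ≤ (m : ℝ) ^ (-(1 + δ)) := by
  have h : 0 ≤ (m : ℝ) ^ (-(1 + δ)) := Real.rpow_nonneg (Nat.cast_nonneg _) _
  rw [omegaTerm, norm_mul, Complex.norm_real, Real.norm_of_nonneg h, norm_pow]
  exact mul_le_of_le_one_left h (pow_le_one₀ (norm_nonneg _) hz)

theorem summable_norm_omegaTerm {z : ℂ} (hz : ‖z‖ ≤ 1) {δ : ℝ} (hδ : 0 < δ) :
    Summable (‖omegaTerm z δ ·‖) :=
  Summable.of_nonneg_of_le (fun _ => norm_nonneg _) (norm_omegaTerm_le hz δ)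
    (summable_rpow_neg_one_add hδ)

theorem prime_rpow_le_inv {δ : ℝ} (hδ : 0 < δ) (p : Nat.Primes) :
    (p : ℝ) ^ (-(1 + δ)) ≤ (p : ℝ)⁻¹ := by
  rw [← Real.rpow_neg_one]
  exact Real.rpow_le_rpow_of_exponent_le (by exact_mod_cast p.2.one_lt.le) (by linarith)

theorem prime_rpow_le_half {δ : ℝ} (hδ : 0 < δ) (p : Nat.Primes) :
    (p : ℝ) ^ (-(1 + δ)) ≤ 1 / 2 := by
  refine (prime_rpow_le_inv hδ p).trans ?_
  rw [one_div]
  have : (2 : ℝ) ≤ p := by exact_mod_cast p.2.two_le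
  gcongr

/-- Since ω(p^e) = 1 for all e ≥ 1, the local factor is 1 + za/(1-a) with a = p^(-(1+δ)). -/
theorem tsum_omegaTerm_prime_pow (z : ℂ) {δ : ℝ} (hδ : 0 < δ) (p : Nat.Primes) :
    ∑' e, omegaTerm z δ ((p : ℕ) ^ e) =
      (1 + (z - 1) * (((p : ℝ) ^ (-(1 + δ)) : ℝ) : ℂ)) *
        (1 - (((p : ℝ) ^ (-(1 + δ)) : ℝ) : ℂ))⁻¹ := by
  set a : ℝ := (p : ℝ) ^ (-(1 + δ)) with ha
  have ha0 : 0 ≤ a := Real.rpow_nonneg (Nat.cast_nonneg _) _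
  have ha1 : a ≤ 1 / 2 := prime_rpow_le_half hδ p
  have hna : ‖(a : ℂ)‖ < 1 := by
    rw [Complex.norm_real, Real.norm_of_nonneg ha0]; linarith
  have hne : (1 : ℂ) - a ≠ 0 := by
    intro h
    have : (a : ℂ) = 1 := (sub_eq_zero.1 h).symm
    rw [this] at hna
    simp at hna
  have hsucc : ∀ e : ℕ, omegaTerm z δ ((p : ℕ) ^ (e + 1)) = z * a * (a : ℂ) ^ e := by
    intro e
    rw [omegaTerm, ArithmeticFunction.cardDistinctFactors_apply_prime_pow p.2 (by simp), pow_one,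
      Nat.cast_pow, ← Real.rpow_natCast, ← Real.rpow_mul (Nat.cast_nonneg _), mul_comm,
      mul_comm ((e + 1 : ℕ) : ℝ), Real.rpow_mul (Nat.cast_nonneg _), Real.rpow_natCast, ← ha]
    push_cast
    ring
  have hgeo := (hasSum_geometric_of_norm_lt_one hna).mul_left (z * a)
  simp only [← hsucc] at hgeo
  rw [((hasSum_nat_add_iff (f := fun e => omegaTerm z δ ((p : ℕ) ^ e)) 1).1 hgeo).tsum_eq,
    Finset.sum_range_one, pow_zero, omegaTerm_one_right]
  field_simp
  ring

theorem norm_sub_one_mul_prime_rpow_le {z : ℂ} (hz1 : ‖z - 1‖ ≤ 1) {δ : ℝ} (hδ : 0 < δ)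
    (p : Nat.Primes) :
    ‖(z - 1) * (((p : ℝ) ^ (-(1 + δ)) : ℝ) : ℂ)‖ ≤ 1 / 2 := by
  have ha0 : 0 ≤ (p : ℝ) ^ (-(1 + δ)) := Real.rpow_nonneg (Nat.cast_nonneg _) _
  rw [norm_mul, Complex.norm_real, Real.norm_of_nonneg ha0]
  exact (mul_le_of_le_one_left ha0 hz1).trans (prime_rpow_le_half hδ p)

theorem summable_prime_rpow {δ : ℝ} (hδ : 0 < δ) :
    Summable fun p : Nat.Primes => (p : ℝ) ^ (-(1 + δ)) :=
  (summable_rpow_neg_one_add hδ).comp_injective Nat.Primes.coe_nat_injective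

theorem summable_sub_one_mul_prime_rpow (z : ℂ) {δ : ℝ} (hδ : 0 < δ) :
    Summable fun p : Nat.Primes => (z - 1) * (((p : ℝ) ^ (-(1 + δ)) : ℝ) : ℂ) :=
  (Complex.summable_ofReal.2 (summable_prime_rpow hδ)).mul_left _

/-- The Euler products for z and for 1 differ by the factors 1 + (z-1)p^(-(1+δ)). The bound on z - 1
keeps these away from 0, so their product is the exponential of the sum of logarithms. -/
theorem tsum_omegaTerm_eq {z : ℂ} (hz : ‖z‖ ≤ 1) (hz1 : ‖z - 1‖ ≤ 1) {δ : ℝ} (hδ : 0 < δ) :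
    ∑' m, omegaTerm z δ m =
      Complex.exp (∑' p : Nat.Primes,
        Complex.log (1 + (z - 1) * (((p : ℝ) ^ (-(1 + δ)) : ℝ) : ℂ))) *
      ((∑' m : ℕ, (m : ℝ) ^ (-(1 + δ)) : ℝ) : ℂ) := by
  have hprod : ∀ {w : ℂ}, ‖w‖ ≤ 1 → HasProd (fun p : Nat.Primes =>
      (1 + (w - 1) * (((p : ℝ) ^ (-(1 + δ)) : ℝ) : ℂ)) *
        (1 - (((p : ℝ) ^ (-(1 + δ)) : ℝ) : ℂ))⁻¹) (∑' m, omegaTerm w δ m) := by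
    intro w hw
    simp only [← tsum_omegaTerm_prime_pow w hδ]
    exact EulerProduct.eulerProduct_hasProd (omegaTerm_one_right w δ)
      (fun h => omegaTerm_mul w δ h) (summable_norm_omegaTerm hw hδ) (omegaTerm_zero_right w hδ)
  have h1 : HasProd (fun p : Nat.Primes => (1 - (((p : ℝ) ^ (-(1 + δ)) : ℝ) : ℂ))⁻¹)
      ((∑' m : ℕ, (m : ℝ) ^ (-(1 + δ)) : ℝ) : ℂ) := by
    have := hprod (w := 1) (by simp)
    simpa [omegaTerm, Complex.ofReal_tsum] using this
  have h2 := Complex.hasProd_of_hasSum_log (fun p => ?_)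
    (Complex.summable_log_one_add_of_summable (summable_sub_one_mul_prime_rpow z hδ)).hasSum
  · exact (hprod hz).unique (h2.mul h1)
  · intro h
    have h3 := norm_sub_one_mul_prime_rpow_le hz1 hδ p
    rw [eq_neg_of_add_eq_zero_right h] at h3
    norm_num at h3

theorem summable_prime_sq_inv : Summable fun p : Nat.Primes => ((p : ℝ) ^ 2)⁻¹ :=
  (Real.summable_nat_pow_inv.2 one_lt_two).comp_injective Nat.Primes.coe_nat_injective

/-- The error of log(1+w) ≈ w is quadratic in w, and p^(-(1+δ)) ≤ 1/p makes the bound uniform as δ →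
0. -/
theorem norm_tsum_log_sub_le {z : ℂ} (hz1 : ‖z - 1‖ ≤ 1) {δ : ℝ} (hδ : 0 < δ) :
    ‖(∑' p : Nat.Primes, Complex.log (1 + (z - 1) * (((p : ℝ) ^ (-(1 + δ)) : ℝ) : ℂ))) -
      (z - 1) * ((∑' p : Nat.Primes, (p : ℝ) ^ (-(1 + δ)) : ℝ) : ℂ)‖ ≤
    ‖z - 1‖ ^ 2 * ∑' p : Nat.Primes, ((p : ℝ) ^ 2)⁻¹ := by
  have hs := summable_sub_one_mul_prime_rpow z hδ
  rw [Complex.ofReal_tsum, ← tsum_mul_left,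
    ← (Complex.summable_log_one_add_of_summable hs).tsum_sub hs]
  refine tsum_of_norm_bounded (summable_prime_sq_inv.hasSum.mul_left _) fun p => ?_
  have hle := norm_sub_one_mul_prime_rpow_le hz1 hδ p
  set w := (z - 1) * (((p : ℝ) ^ (-(1 + δ)) : ℝ) : ℂ) with hw
  refine (Complex.norm_log_one_add_sub_self_le (by linarith)).trans ?_
  have hinv : (1 - ‖w‖)⁻¹ ≤ 2 := by
    rw [inv_le_comm₀ (by linarith) two_pos]; linarith
  have hwn : ‖w‖ ≤ ‖z - 1‖ * (p : ℝ)⁻¹ := by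
    have ha0 : 0 ≤ (p : ℝ) ^ (-(1 + δ)) := Real.rpow_nonneg (Nat.cast_nonneg _) _
    rw [hw, norm_mul, Complex.norm_real, Real.norm_of_nonneg ha0]
    gcongr
    exact prime_rpow_le_inv hδ p
  calc ‖w‖ ^ 2 * (1 - ‖w‖)⁻¹ / 2 ≤ ‖w‖ ^ 2 * 2 / 2 := by gcongr
    _ = ‖w‖ ^ 2 := by ring
    _ ≤ (‖z - 1‖ * (p : ℝ)⁻¹) ^ 2 := by gcongr
    _ = _ := by rw [mul_pow, inv_pow]

/-- The prime zeta function differs from the logarithm of the zeta function by a bounded amount. -/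
theorem abs_tsum_prime_rpow_sub_log_le {δ : ℝ} (hδ : 0 < δ) :
    |(∑' p : Nat.Primes, (p : ℝ) ^ (-(1 + δ))) - Real.log (∑' m : ℕ, (m : ℝ) ^ (-(1 + δ)))| ≤
      ∑' p : Nat.Primes, ((p : ℝ) ^ 2)⁻¹ := by
  have hZ : 0 < ∑' m : ℕ, (m : ℝ) ^ (-(1 + δ)) :=
    (summable_rpow_neg_one_add hδ).tsum_pos (fun m => Real.rpow_nonneg (Nat.cast_nonneg _) _) 1
      (by simp)
  -- At z = 0 only m = 1 survives, so the identity reads 1 = exp(w) ζ(1+δ); its norm gives log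
  -- ζ(1+δ) = -Re w, while `h2` says that -w is close to the prime zeta function.
  have h1 := tsum_omegaTerm_eq (z := 0) (by simp) (by simp) hδ
  have h2 := norm_tsum_log_sub_le (z := 0) (by simp) hδ
  rw [tsum_eq_single 1, omegaTerm_one_right] at h1
  · set w := ∑' p : Nat.Primes, Complex.log (1 + (0 - 1) * (((p : ℝ) ^ (-(1 + δ)) : ℝ) : ℂ))
    have h3 : Real.exp w.re * ∑' m : ℕ, (m : ℝ) ^ (-(1 + δ)) = 1 := by
      have := congrArg norm h1
      rw [norm_one, norm_mul, Complex.norm_exp, Complex.norm_real, Real.norm_of_nonneg hZ.le] at this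
      exact this.symm
    have h4 : Real.log (∑' m : ℕ, (m : ℝ) ^ (-(1 + δ))) = -w.re := by
      rw [eq_inv_of_mul_eq_one_right h3, Real.log_inv, Real.log_exp]
    rw [h4]
    have h5 := (Complex.abs_re_le_norm _).trans h2
    simpa [add_comm] using h5
  · intro m hm
    rcases Nat.eq_zero_or_pos m with rfl | hpos
    · exact omegaTerm_zero_right _ hδ
    · have : ArithmeticFunction.cardDistinctFactors m ≠ 0 := by
        rw [Ne, ArithmeticFunction.cardDistinctFactors_eq_zero]
        omega
      simp only [omegaTerm, zero_pow this, zero_mul]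

/-! ### The Gaussian limit under zeta weights -/

/-- This is the simple pole of ζ at 1, with residue 1. -/
theorem tendsto_zeta_div {l : ℝ} (hl : 0 < l) :
    Tendsto (fun x : ℝ => x⁻¹ * ∑' m : ℕ, (m : ℝ) ^ (-(1 + l / x))) atTop (𝓝 (1 / l)) := by
  have h0 : Tendsto (fun x : ℝ => 1 + l / x) atTop (𝓝[>] 1) := by
    refine tendsto_nhdsWithin_iff.2 ⟨?_, ?_⟩
    · simpa using (tendsto_const_nhds (x := l)).div_atTop tendsto_id |>.const_add 1
    · filter_upwards [eventually_gt_atTop 0] with x hx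
      have : 0 < l / x := by positivity
      simpa using this
  have h1 := (tendsto_sub_mul_tsum_nat_rpow.comp h0).mul_const (1 / l)
  rw [one_mul] at h1
  refine h1.congr' ?_
  filter_upwards [eventually_gt_atTop 0] with x hx
  have : ∀ m : ℕ, 1 / (m : ℝ) ^ (1 + l / x) = (m : ℝ) ^ (-(1 + l / x)) := fun m => by
    rw [Real.rpow_neg (Nat.cast_nonneg _), one_div]
  simp only [Function.comp_apply, this]
  field_simp
  ring

/-- Taylor expansion of the exponential: centring removes the linear term, the quadratic one is the
limit, and the cubic remainder times L is at most |t|³/√L. -/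
theorem tendsto_gaussian_exponent (t : ℝ) :
    Tendsto (fun L : ℝ => (Complex.exp (Complex.I * t / (√L : ℝ)) - 1) * (L : ℂ) -
      Complex.I * t * (L : ℂ) / (√L : ℝ)) atTop (𝓝 (-(t : ℂ) ^ 2 / 2)) := by
  rw [tendsto_iff_norm_sub_tendsto_zero]
  have hlim : Tendsto (fun L : ℝ => |t| ^ 3 / √L) atTop (𝓝 0) :=
    tendsto_const_nhds.div_atTop Real.tendsto_sqrt_atTop
  refine squeeze_zero' (.of_forall fun _ => norm_nonneg _) ?_ hlim
  filter_upwards [eventually_gt_atTop 0, Real.tendsto_sqrt_atTop.eventually_ge_atTop |t|]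
    with L hL hLt
  have hs : 0 < √L := Real.sqrt_pos.2 hL
  set w : ℂ := Complex.I * t / (√L : ℝ) with hw
  have hwn : ‖w‖ = |t| / √L := by
    simp [hw, abs_of_nonneg hs.le]
  have hsq : ((√L : ℝ) : ℂ) ^ 2 = L := by exact_mod_cast Real.sq_sqrt hL.le
  have hsne : ((√L : ℝ) : ℂ) ≠ 0 := by exact_mod_cast hs.ne'
  have hb := Complex.exp_bound (x := w) (n := 3) (by rw [hwn]; exact div_le_one_of_le₀ hLt hs.le)
    (by norm_num)
  have e : (Complex.exp w - 1) * (L : ℂ) - Complex.I * t * (L : ℂ) / (√L : ℝ) -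
      -(t : ℂ) ^ 2 / 2 =
      (Complex.exp w - ∑ m ∈ Finset.range 3, w ^ m / (m.factorial : ℂ)) * L := by
    have h2 : w ^ 2 * L = -(t : ℂ) ^ 2 := by
      rw [hw, ← hsq]; field_simp; rw [Complex.I_sq]; ring
    have h1 : Complex.I * t * (L : ℂ) / (√L : ℝ) = w * L := by rw [hw]; ring
    rw [h1, ← h2]
    simp [Finset.sum_range_succ]
    ring
  rw [e, norm_mul, Complex.norm_real, Real.norm_of_nonneg hL.le]
  calc _ ≤ ‖w‖ ^ 3 * 1 * L := by
        gcongr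
        refine hb.trans ?_
        gcongr
        norm_num [Nat.factorial]
    _ = |t| ^ 3 / √L := by
        rw [hwn]
        nth_rewrite 2 [← Real.sq_sqrt hL.le]
        field_simp

/-- The characteristic function of the normalised `ω` under the zeta distribution with parameter
`1 + l / x`, scaled so that the total mass tends to `1 / l`. -/
theorem tendsto_zeta_charFun (t : ℝ) {l : ℝ} (hl : 0 < l) :
    Tendsto (fun x : ℝ => ∑' m : ℕ,
      Complex.exp (Complex.I * t *
        ((ArithmeticFunction.cardDistinctFactors m : ℂ) - (Real.log x : ℝ)) /
          (√(Real.log x) : ℝ)) *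
      ((x⁻¹ * (m : ℝ) ^ (-(1 + l / x)) : ℝ) : ℂ)) atTop
      (𝓝 (Complex.exp (-(t : ℂ) ^ 2 / 2) * (1 / l : ℝ))) := by
  set K := ∑' p : Nat.Primes, ((p : ℝ) ^ 2)⁻¹
  set z : ℝ → ℂ := fun x => Complex.exp (Complex.I * t / (√(Real.log x) : ℝ)) with hz
  set P : ℝ → ℝ := fun x => ∑' p : Nat.Primes, (p : ℝ) ^ (-(1 + l / x)) with hP
  set S : ℝ → ℂ := fun x => ∑' p : Nat.Primes,
    Complex.log (1 + (z x - 1) * (((p : ℝ) ^ (-(1 + l / x)) : ℝ) : ℂ)) with hS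
  set Z : ℝ → ℝ := fun x => ∑' m : ℕ, (m : ℝ) ^ (-(1 + l / x)) with hZ
  have hZlim : Tendsto (fun x => x⁻¹ * Z x) atTop (𝓝 (1 / l)) := tendsto_zeta_div hl
  have hznorm : ∀ x, ‖z x‖ = 1 := fun x => by
    have : Complex.I * t / (√(Real.log x) : ℝ) = ((t / √(Real.log x) : ℝ) : ℂ) * Complex.I := by
      push_cast; ring
    simp only [hz]
    rw [this, Complex.norm_exp_ofReal_mul_I]
  have hzlim : Tendsto (fun x => ‖z x - 1‖) atTop (𝓝 0) := by
    have h0 : Tendsto (fun x : ℝ => t / √(Real.log x)) atTop (𝓝 0) :=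
      tendsto_const_nhds.div_atTop (Real.tendsto_sqrt_atTop.comp Real.tendsto_log_atTop)
    have hc : Continuous fun y : ℝ => ‖Complex.exp (Complex.I * y) - 1‖ := by fun_prop
    have := (hc.tendsto 0).comp h0
    simp only [Function.comp_def, Complex.ofReal_zero, mul_zero, Complex.exp_zero, sub_self,
      norm_zero] at this
    refine this.congr fun x => ?_
    simp only [hz]
    push_cast
    rw [mul_div_assoc]
  have hz1 : ∀ᶠ x in atTop, ‖z x - 1‖ ≤ 1 :=
    (hzlim.eventually (gt_mem_nhds one_pos)).mono fun _ h => h.le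
  have hδ : ∀ᶠ x : ℝ in atTop, 0 < l / x := by
    filter_upwards [eventually_gt_atTop 0] with x hx
    positivity
  have hE : Tendsto (fun x => S x - (z x - 1) * (P x : ℂ)) atTop (𝓝 0) := by
    rw [tendsto_zero_iff_norm_tendsto_zero]
    refine squeeze_zero' (.of_forall fun _ => norm_nonneg _) ?_
      (by simpa using (hzlim.pow 2).mul_const K)
    filter_upwards [hz1, hδ] with x h1 h2
    exact norm_tsum_log_sub_le h1 h2
  -- log ζ(1+l/x) = log x + log(1/l) + o(1) by the pole, and the prime zeta function is within K of
  -- it.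
  have hPL : ∀ᶠ x in atTop, |P x - Real.log x| ≤ K + (|Real.log (1 / l)| + 1) := by
    have h1 : Tendsto (fun x => |Real.log (x⁻¹ * Z x)|) atTop (𝓝 |Real.log (1 / l)|) :=
      (hZlim.log (by positivity)).abs
    filter_upwards [h1.eventually (gt_mem_nhds (lt_add_one _)), hδ, eventually_gt_atTop 0,
      hZlim.eventually (lt_mem_nhds (show 0 < 1 / l by positivity))] with x h1 h2 h3 h4
    have hZpos : 0 < Z x := pos_of_mul_pos_right h4 (inv_nonneg.2 h3.le)
    have h5 := abs_tsum_prime_rpow_sub_log_le h2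
    rw [Real.log_mul (inv_pos.2 h3).ne' hZpos.ne', Real.log_inv] at h1
    calc |P x - Real.log x| = |(P x - Real.log (Z x)) + (-Real.log x + Real.log (Z x))| := by
          congr 1; ring
      _ ≤ _ := (abs_add_le _ _).trans (add_le_add h5 h1.le)
  have hB : Tendsto (fun x => (z x - 1) * ((P x - Real.log x : ℝ) : ℂ)) atTop (𝓝 0) := by
    rw [tendsto_zero_iff_norm_tendsto_zero]
    refine squeeze_zero' (.of_forall fun _ => norm_nonneg _) ?_
      (by simpa only [zero_mul] using hzlim.mul_const (K + (|Real.log (1 / l)| + 1)))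
    filter_upwards [hPL] with x hx
    rw [norm_mul, Complex.norm_real, Real.norm_eq_abs]
    gcongr
  have hG := (tendsto_gaussian_exponent t).comp Real.tendsto_log_atTop
  have hsum := (hE.add hB).add hG
  rw [zero_add, zero_add] at hsum
  have hfin := hsum.cexp.mul ((Complex.continuous_ofReal.tendsto _).comp hZlim)
  refine hfin.congr' ?_
  filter_upwards [hz1, hδ] with x h1 h2
  have hT := tsum_omegaTerm_eq (hznorm x).le h1 h2
  have hterm : ∀ m : ℕ, Complex.exp (Complex.I * t *
        ((ArithmeticFunction.cardDistinctFactors m : ℂ) - (Real.log x : ℝ)) /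
          (√(Real.log x) : ℝ)) * ((x⁻¹ * (m : ℝ) ^ (-(1 + l / x)) : ℝ) : ℂ) =
      Complex.exp (-(Complex.I * t * (Real.log x : ℝ) / (√(Real.log x) : ℝ))) * (x⁻¹ : ℝ) *
        omegaTerm (z x) (l / x) m := by
    intro m
    rw [omegaTerm, ← Complex.exp_nat_mul, show Complex.I * t *
        ((ArithmeticFunction.cardDistinctFactors m : ℂ) - (Real.log x : ℝ)) /
          (√(Real.log x) : ℝ) =
        -(Complex.I * t * (Real.log x : ℝ) / (√(Real.log x) : ℝ)) +
        (ArithmeticFunction.cardDistinctFactors m : ℂ) *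
          (Complex.I * t / (√(Real.log x) : ℝ)) by ring, Complex.exp_add, Complex.ofReal_mul]
    ring
  simp only [hterm]
  rw [tsum_mul_left, hT]
  simp only [Function.comp_apply]
  -- The terms in P x and log x telescope, leaving the logarithm of the Euler product plus the
  -- centring.
  rw [show S x - (z x - 1) * (P x : ℂ) + (z x - 1) * ((P x - Real.log x : ℝ) : ℂ) +
      ((Complex.exp (Complex.I * t / (√(Real.log x) : ℝ)) - 1) * (Real.log x : ℂ) -
      Complex.I * t * (Real.log x : ℂ) / (√(Real.log x) : ℝ)) =
      S x + -(Complex.I * t * (Real.log x : ℝ) / (√(Real.log x) : ℝ)) by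
    simp only [hz]
    push_cast
    ring, Complex.exp_add, Complex.ofReal_mul]
  ring

/-! ### Logarithmic averages up to N -/

theorem norm_exp_I_mul_omega (t L : ℝ) (m : ℕ) :
    ‖Complex.exp (Complex.I * t *
      ((ArithmeticFunction.cardDistinctFactors m : ℂ) - (L : ℝ)) / (√L : ℝ))‖ = 1 := by
  rw [show Complex.I * t * ((ArithmeticFunction.cardDistinctFactors m : ℂ) - (L : ℝ)) /
      (√L : ℝ) = ((t * ((ArithmeticFunction.cardDistinctFactors m : ℝ) - L) / √L : ℝ) : ℂ) *
      Complex.I by push_cast; ring, Complex.norm_exp_ofReal_mul_I]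

theorem natCast_rpow_mem_Icc (m : ℕ) {x : ℝ} (hx : 0 < x) :
    (m : ℝ) ^ (-(1 / x)) ∈ Set.Icc (0 : ℝ) 1 := by
  have hneg : -(1 / x) < 0 := neg_lt_zero.2 (one_div_pos.2 hx)
  refine ⟨Real.rpow_nonneg (Nat.cast_nonneg _) _, ?_⟩
  rcases Nat.eq_zero_or_pos m with rfl | hm
  · rw [Nat.cast_zero, Real.zero_rpow hneg.ne]; exact zero_le_one
  · exact Real.rpow_le_one_of_one_le_of_nonpos (by exact_mod_cast hm) hneg.le

/-- Hence the k-th moment of m^(-1/x) under the weights is a zeta sum with l = k+1. -/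
theorem rpow_weight_mul_pow (m k : ℕ) {x : ℝ} (hx : 0 < x) :
    x⁻¹ * (m : ℝ) ^ (-(1 + 1 / x)) * ((m : ℝ) ^ (-(1 / x))) ^ k =
      x⁻¹ * (m : ℝ) ^ (-(1 + (k + 1) / x)) := by
  have h1 : 0 < 1 / x := by positivity
  have h2 : 0 < ((k : ℝ) + 1) / x := by positivity
  -- The index m = 0 carries no weight, since 0 to a nonzero real power is 0.
  rcases Nat.eq_zero_or_pos m with rfl | hm
  · rw [Nat.cast_zero, Real.zero_rpow (by linarith), Real.zero_rpow (x := -(1 + (k + 1) / x))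
      (by linarith)]
    simp
  · rw [mul_assoc, ← Real.rpow_natCast, ← Real.rpow_mul (Nat.cast_nonneg _),
      ← Real.rpow_add (by exact_mod_cast hm)]
    congr 2
    ring

/-- For m ≥ 1, m^(-1/log N) ≥ 1/e exactly when m ≤ N, and the kernel 1/u cancels the surplus factor
m^(-1/log N) of the weight. -/
theorem rpow_weight_mul_cutoff {N m : ℕ} (hN : 1 < N) :
    (Real.log N)⁻¹ * (m : ℝ) ^ (-(1 + 1 / Real.log N)) *
      (if Real.exp (-1) ≤ (m : ℝ) ^ (-(1 / Real.log N)) then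
        ((m : ℝ) ^ (-(1 / Real.log N)))⁻¹ else 0) =
      if m ∈ Finset.Icc 1 N then (Real.log N)⁻¹ * (m : ℝ)⁻¹ else 0 := by
  have hx : 0 < Real.log N := Real.log_pos (by exact_mod_cast hN)
  have h1 : 0 < 1 / Real.log N := by positivity
  rcases Nat.eq_zero_or_pos m with rfl | hm
  · rw [Nat.cast_zero, Real.zero_rpow (by linarith)]
    simp
  · have hm' : (0 : ℝ) < m := by exact_mod_cast hm
    have hiff : Real.exp (-1) ≤ (m : ℝ) ^ (-(1 / Real.log N)) ↔ m ∈ Finset.Icc 1 N := by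
      rw [Real.rpow_def_of_pos hm', Real.exp_le_exp, Finset.mem_Icc, mul_neg, neg_le_neg_iff,
        mul_one_div, div_le_one hx, Real.log_le_log_iff hm' (by exact_mod_cast (by omega : 0 < N)),
        Nat.cast_le]
      exact ⟨fun h => ⟨hm, h⟩, fun h => h.2⟩
    simp only [hiff]
    split_ifs
    · rw [mul_assoc, ← Real.rpow_neg hm'.le, ← Real.rpow_add hm', ← Real.rpow_neg_one (m : ℝ)]
      congr 2
      ring
    · simp

/-- Logarithmic averages of the characters of the normalised `ω` converge to the characteristic
function of the standard normal distribution. -/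
theorem tendsto_log_average_exp_omega (t : ℝ) :
    Tendsto (fun N : ℕ => (Real.log N : ℂ)⁻¹ * ∑ m ∈ Finset.Icc 1 N,
      Complex.exp (Complex.I * t *
        ((ArithmeticFunction.cardDistinctFactors m : ℂ) - (Real.log (Real.log N) : ℝ)) /
          (√(Real.log (Real.log N)) : ℝ)) * (m : ℂ)⁻¹) atTop
      (𝓝 (Complex.exp (-(t : ℂ) ^ 2 / 2))) := by
  -- Shifting by 2 makes log N positive at every index. Below, the cutoff a = 1/e gives -log a = 1.
  rw [← tendsto_add_atTop_iff_nat 2]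
  have hx : ∀ N : ℕ, 0 < Real.log ((N + 2 : ℕ) : ℝ) := fun N =>
    Real.log_pos (by exact_mod_cast (by omega : 1 < N + 2))
  have hlim : Tendsto (fun N : ℕ => Real.log ((N + 2 : ℕ) : ℝ)) atTop atTop :=
    Real.tendsto_log_atTop.comp (tendsto_natCast_atTop_atTop.comp (tendsto_add_atTop_nat 2))
  have hmain := tendsto_tsum_cutoff
    (F := fun N m => Complex.exp (Complex.I * t *
        ((ArithmeticFunction.cardDistinctFactors m : ℂ) -
          (Real.log (Real.log ((N + 2 : ℕ) : ℝ)) : ℝ)) /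
          (√(Real.log (Real.log ((N + 2 : ℕ) : ℝ))) : ℝ)))
    (W := fun N m => (Real.log ((N + 2 : ℕ) : ℝ))⁻¹ *
      (m : ℝ) ^ (-(1 + 1 / Real.log ((N + 2 : ℕ) : ℝ))))
    (u := fun N m => (m : ℝ) ^ (-(1 / Real.log ((N + 2 : ℕ) : ℝ))))
    (c := Complex.exp (-(t : ℂ) ^ 2 / 2)) (a := Real.exp (-1)) (Real.exp_pos _)
    (by rw [Real.exp_lt_one_iff]; norm_num) (fun N m => (norm_exp_I_mul_omega _ _ _).le)
    (fun N m => mul_nonneg (inv_nonneg.2 (hx N).le) (Real.rpow_nonneg (Nat.cast_nonneg _) _))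
    (fun N => (summable_rpow_neg_one_add (one_div_pos.2 (hx N))).mul_left _)
    (fun N m => natCast_rpow_mem_Icc m (hx N)) (fun k => ?_) (fun k => ?_)
  · rw [Real.log_exp, neg_neg, Complex.ofReal_one, mul_one] at hmain
    refine hmain.congr fun N => ?_
    rw [kernelSum, tsum_eq_sum (s := Finset.Icc 1 (N + 2)), Finset.mul_sum]
    · refine Finset.sum_congr rfl fun m hm => ?_
      rw [rpow_weight_mul_cutoff (by omega), if_pos hm]
      push_cast
      ring
    · intro m hm
      rw [rpow_weight_mul_cutoff (by omega), if_neg hm, Complex.ofReal_zero, mul_zero]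
  · refine ((tendsto_zeta_div (l := k + 1) (by positivity)).comp hlim).congr fun N => ?_
    rw [Function.comp_apply, ← tsum_mul_left]
    exact tsum_congr fun m => (rpow_weight_mul_pow m k (hx N)).symm
  · refine ((tendsto_zeta_charFun t (l := k + 1) (by positivity)).comp hlim).congr fun N => ?_
    rw [Function.comp_apply, kernelSum]
    exact tsum_congr fun m => by rw [rpow_weight_mul_pow m k (hx N)]

theorem tendsto_harmonicNumber_div_log :
    Tendsto (fun N : ℕ => (Real.log N)⁻¹ * ∑ m ∈ Finset.Icc 1 N, (m : ℝ)⁻¹) atTop (𝓝 1) := by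
  have h := tendsto_log_average_exp_omega 0
  simp only [Complex.ofReal_zero, mul_zero, zero_mul, zero_div, Complex.exp_zero, one_mul, ne_eq,
    OfNat.ofNat_ne_zero, not_false_eq_true, zero_pow, neg_zero] at h
  refine ((Complex.continuous_re.tendsto _).comp h).congr fun N => ?_
  rw [Function.comp_apply, ← Complex.ofReal_re ((Real.log N)⁻¹ * _)]
  push_cast
  rfl

/-! ### Convergence in law under the harmonic distribution -/

theorem harmonicPMF_apply_toReal (n : ℕ+) (i : ℕ) :
    (harmonicPMF n i).toReal =
      if i ∈ Finset.Icc 1 (n : ℕ) then 1 / ((i : ℝ) * harmonicNumber n) else 0 := by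
  have h := harmonicNumber_pos n
  rw [harmonicPMF, PMF.ofFinset_apply]
  split_ifs
  · exact ENNReal.toReal_ofReal (by positivity)
  · simp

theorem integral_harmonicPMF (n : ℕ+) {f : ℕ → ℂ} (hf : ∀ m, ‖f m‖ ≤ 1) :
    ∫ m, f m ∂(harmonicPMF n).toMeasure =
      (∑ m ∈ Finset.Icc 1 (n : ℕ), f m * (m : ℂ)⁻¹) / (harmonicNumber n : ℂ) := by
  have hint : MeasureTheory.Integrable f (harmonicPMF n).toMeasure :=
    .of_bound (Measurable.of_discrete.aestronglyMeasurable) 1 (.of_forall hf)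
  rw [PMF.integral_eq_tsum _ _ hint, tsum_eq_sum (s := Finset.Icc 1 (n : ℕ)), Finset.sum_div]
  · refine Finset.sum_congr rfl fun m hm => ?_
    rw [harmonicPMF_apply_toReal, if_pos hm, Complex.real_smul]
    push_cast
    rw [one_div, mul_inv, div_eq_mul_inv]
    ring
  · intro m hm
    rw [harmonicPMF_apply_toReal, if_neg hm, zero_smul]

/-- The law of `ω(m)`, centred and normalised by `log log n`, for an `H_n`-distributed `m`. -/
noncomputable def normalizedOmegaLaw (n : ℕ+) : MeasureTheory.ProbabilityMeasure ℝ :=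
  ⟨(harmonicPMF n).toMeasure.map fun m =>
    ((ArithmeticFunction.cardDistinctFactors m : ℝ) - Real.log (Real.log n)) /
      √(Real.log (Real.log n)),
    MeasureTheory.Measure.isProbabilityMeasure_map Measurable.of_discrete.aemeasurable⟩

theorem charFun_normalizedOmegaLaw (n : ℕ+) (t : ℝ) :
    MeasureTheory.charFun (normalizedOmegaLaw n : MeasureTheory.Measure ℝ) t =
      (∑ m ∈ Finset.Icc 1 (n : ℕ), Complex.exp (Complex.I * t *
        ((ArithmeticFunction.cardDistinctFactors m : ℂ) - (Real.log (Real.log n) : ℝ)) /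
          (√(Real.log (Real.log n)) : ℝ)) * (m : ℂ)⁻¹) / (harmonicNumber n : ℂ) := by
  rw [MeasureTheory.charFun_apply_real, ← integral_harmonicPMF n
    (fun m => (norm_exp_I_mul_omega t (Real.log (Real.log n)) m).le)]
  change ∫ x, _ ∂(MeasureTheory.Measure.map _ _) = _
  rw [MeasureTheory.integral_map Measurable.of_discrete.aemeasurable
    (by fun_prop)]
  refine MeasureTheory.integral_congr_ae (.of_forall fun m => ?_)
  simp only
  congr 1
  push_cast
  ring

/-- The standard normal distribution as a probability measure. -/
noncomputable def standardGaussian : MeasureTheory.ProbabilityMeasure ℝ :=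
  ⟨ProbabilityTheory.gaussianReal 0 1, inferInstance⟩

theorem coe_standardGaussian :
    (standardGaussian : MeasureTheory.Measure ℝ) = ProbabilityTheory.gaussianReal 0 1 := rfl

/-- By Lévy's continuity theorem it suffices to treat characteristic functions; these are quotients
of two logarithmic averages, in which 1/log N cancels. -/
theorem tendsto_normalizedOmegaLaw :
    Tendsto (fun N : ℕ => normalizedOmegaLaw N.toPNat') atTop (𝓝 standardGaussian) := by
  rw [MeasureTheory.ProbabilityMeasure.tendsto_iff_tendsto_charFun]
  intro t
  have hgauss : MeasureTheory.charFun (standardGaussian : MeasureTheory.Measure ℝ) t =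
      Complex.exp (-(t : ℂ) ^ 2 / 2) := by
    rw [coe_standardGaussian, ProbabilityTheory.charFun_gaussianReal]
    congr 1
    push_cast
    ring
  have hh := (Complex.continuous_ofReal.tendsto _).comp tendsto_harmonicNumber_div_log
  have hlim := (tendsto_log_average_exp_omega t).div hh (by simp)
  rw [Complex.ofReal_one, div_one, ← hgauss] at hlim
  refine hlim.congr' ?_
  filter_upwards [eventually_gt_atTop 1] with N hN
  have hN' : ((N.toPNat' : ℕ+) : ℕ) = N := by
    rw [Nat.toPNat'_coe, if_pos (by omega)]
  have hlog : (Real.log N : ℂ) ≠ 0 := by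
    exact_mod_cast (Real.log_pos (by exact_mod_cast hN)).ne'
  rw [charFun_normalizedOmegaLaw, harmonicNumber_eq_sum, hN', Pi.div_apply, Function.comp_apply,
    Complex.ofReal_mul, Complex.ofReal_inv]
  simp only [one_div]
  rw [mul_div_mul_left _ _ (inv_ne_zero hlog)]

/-- Portmanteau: the boundary {x} of the half-line is null because the Gaussian has no atoms. -/
theorem harmonicPMF_erdos_kac (x : ℝ) :
    Tendsto
      (fun n : ℕ+ => (harmonicPMF n).toMeasure.real
        {m : ℕ | (ArithmeticFunction.cardDistinctFactors m : ℝ) - Real.log (Real.log (n : ℝ))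
          ≤ x * Real.sqrt (Real.log (Real.log (n : ℝ)))})
      atTop
      (𝓝 ((ProbabilityTheory.gaussianReal 0 1).real (Set.Iic x))) := by
  have hatom : MeasureTheory.NullSingletonClass (ProbabilityTheory.gaussianReal 0 1) :=
    ProbabilityTheory.nullSingletonClass_gaussianReal one_ne_zero
  have h := MeasureTheory.ProbabilityMeasure.tendsto_measure_of_null_frontier_of_tendsto
    tendsto_normalizedOmegaLaw (E := Set.Iic x) (by
      rw [frontier_Iic]
      apply NNReal.coe_injective
      rw [MeasureTheory.ProbabilityMeasure.coeFn_def, coe_standardGaussian]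
      simp)
  have h1 := ((NNReal.continuous_coe.tendsto _).comp h).comp tendsto_PNat_val_atTop_atTop
  refine h1.congr' ?_
  have hlog : ∀ᶠ n : ℕ+ in atTop, 0 < √(Real.log (Real.log (n : ℝ))) :=
    (Real.tendsto_sqrt_atTop.comp (Real.tendsto_log_atTop.comp (Real.tendsto_log_atTop.comp
      (tendsto_natCast_atTop_atTop.comp tendsto_PNat_val_atTop_atTop)))).eventually_gt_atTop 0
  filter_upwards [hlog] with n hn
  have hset : {m : ℕ | (ArithmeticFunction.cardDistinctFactors m : ℝ) -
      Real.log (Real.log (n : ℝ)) ≤ x * √(Real.log (Real.log (n : ℝ)))} =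
      (fun m : ℕ => ((ArithmeticFunction.cardDistinctFactors m : ℝ) - Real.log (Real.log n)) /
        √(Real.log (Real.log n))) ⁻¹' Set.Iic x := by
    ext m
    simp only [Set.mem_ofPred_eq, Set.mem_preimage, Set.mem_Iic]
    rw [div_le_iff₀ hn]
  rw [hset, MeasureTheory.measureReal_def, ← MeasureTheory.Measure.map_apply
    Measurable.of_discrete measurableSet_Iic]
  simp only [Function.comp_apply]
  have hn' : (PNat.val n).toPNat' = n := PNat.coe_toPNat' n
  rw [hn']
  rfl

/-! ### The E-K constraints -/

theorem sum_deviation_harmonicPMF (n : ℕ+) {d : ℕ} (hd : 0 < d) :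
    ∑ l ∈ Finset.Icc 1 ((n : ℕ) / d), deviation harmonicPMF (l * d) n =
      ((harmonic ((n : ℕ) / d) : ℚ) : ℝ) / (d * harmonicNumber n) -
        (((n : ℕ) / d : ℕ) : ℝ) / n := by
  have hterm : ∀ l ∈ Finset.Icc 1 ((n : ℕ) / d), deviation harmonicPMF (l * d) n =
      (l : ℝ)⁻¹ * (1 / (d * harmonicNumber n)) - 1 / (n : ℝ) := by
    intro l hl
    rw [Finset.mem_Icc] at hl
    have h1 : l * d ≤ n := (Nat.le_div_iff_mul_le hd).1 hl.2
    have h2 : 1 ≤ l * d := Nat.mul_pos hl.1 hd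
    rw [deviation, harmonicPMF_apply_toReal, if_pos (Finset.mem_Icc.2 ⟨h2, h1⟩), Nat.cast_mul,
      mul_assoc, one_div, mul_inv, one_div (_ * _)]
  rw [Finset.sum_congr rfl hterm, Finset.sum_sub_distrib, ← Finset.sum_mul, Finset.sum_const,
    Nat.card_Icc, harmonic_eq_sum_Icc]
  push_cast
  simp only [nsmul_eq_mul]
  ring

theorem harmonic_div_le (n : ℕ+) (d : ℕ) :
    ((harmonic ((n : ℕ) / d) : ℚ) : ℝ) / harmonicNumber n ≤ 1 := by
  refine div_le_one_of_le₀ ?_ (harmonicNumber_pos n).le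
  rw [harmonicNumber_eq_sum, harmonic_eq_sum_Icc]
  push_cast
  simp only [one_div]
  exact Finset.sum_le_sum_of_subset_of_nonneg (Finset.Icc_subset_Icc_right (Nat.div_le_self _ _))
    fun _ _ _ => by positivity

theorem sum_deviation_le_one_div (n : ℕ+) {d : ℕ} (hd : 0 < d) :
    ∑ l ∈ Finset.Icc 1 ((n : ℕ) / d), deviation harmonicPMF (l * d) n ≤ 1 / (d : ℝ) := by
  have hd' : (0 : ℝ) < d := by exact_mod_cast hd
  rw [sum_deviation_harmonicPMF n hd, mul_comm, ← div_div]
  have h1 : 0 ≤ (((n : ℕ) / d : ℕ) : ℝ) / n := by positivity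
  have h2 := div_le_div_of_nonneg_right (harmonic_div_le n d) hd'.le
  linarith

/-- The sum is at most 1/d - ⌊n/d⌋/n, and rounding n/d down loses at most 1; hence D = 1. -/
theorem sum_deviation_le_one_div_self (n : ℕ+) {d : ℕ} (hd : 0 < d) :
    ∑ l ∈ Finset.Icc 1 ((n : ℕ) / d), deviation harmonicPMF (l * d) n ≤ 1 / (n : ℝ) := by
  have hd' : (0 : ℝ) < d := by exact_mod_cast hd
  have hn : (0 : ℝ) < n := by exact_mod_cast n.pos
  rw [sum_deviation_harmonicPMF n hd, mul_comm, ← div_div]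
  have h2 := div_le_div_of_nonneg_right (harmonic_div_le n d) hd'.le
  have h3 : (n : ℝ) ≤ ((((n : ℕ) / d : ℕ) : ℝ) + 1) * d := by
    exact_mod_cast (Nat.lt_mul_div_succ (n : ℕ) hd).le.trans (mul_comm _ _).le
  have h4 : 1 / (d : ℝ) ≤ ((((n : ℕ) / d : ℕ) : ℝ) + 1) / n := by
    rw [div_le_div_iff₀ hd' hn]
    linarith
  rw [add_div] at h4
  linarith

/-- The bounds log(n+1) ≤ h_n ≤ 1 + log n give h_n - h_{⌊n/d⌋} ≤ 1 + log d, which is negligible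
against h_n → ∞. -/
theorem tendsto_harmonic_div_ratio {d : ℕ} (hd : 0 < d) :
    Tendsto (fun n : ℕ+ => ((harmonic ((n : ℕ) / d) : ℚ) : ℝ) / harmonicNumber n) atTop (𝓝 1) := by
  have hd' : (0 : ℝ) < d := by exact_mod_cast hd
  have hlog : Tendsto (fun n : ℕ+ => Real.log ((n : ℕ) : ℝ)) atTop atTop :=
    Real.tendsto_log_atTop.comp
      (tendsto_natCast_atTop_atTop.comp tendsto_PNat_val_atTop_atTop)
  have hH : Tendsto harmonicNumber atTop atTop := by
    refine tendsto_atTop_mono (fun n => ?_) hlog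
    refine le_trans ?_ (log_add_one_le_harmonic n)
    exact Real.log_le_log (by exact_mod_cast n.pos) (by push_cast; linarith)
  have hlow : Tendsto (fun n : ℕ+ => 1 - (1 + Real.log d) / harmonicNumber n) atTop (𝓝 1) := by
    simpa using (tendsto_const_nhds (x := 1 + Real.log d)).div_atTop hH |>.const_sub 1
  refine tendsto_of_tendsto_of_tendsto_of_le_of_le hlow tendsto_const_nhds (fun n => ?_)
    fun n => harmonic_div_le n d
  have hpos := harmonicNumber_pos n
  have hn : (0 : ℝ) < ((n : ℕ) : ℝ) := by exact_mod_cast n.pos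
  have h1 : harmonicNumber n ≤ 1 + Real.log ((n : ℕ) : ℝ) := harmonic_le_one_add_log n
  have h2 := log_add_one_le_harmonic ((n : ℕ) / d)
  have h3 : ((n : ℕ) : ℝ) / d ≤ (((n : ℕ) / d + 1 : ℕ) : ℝ) := by
    rw [div_le_iff₀ hd']
    exact_mod_cast (Nat.lt_mul_div_succ (n : ℕ) hd).le.trans (mul_comm _ _).le
  have h4 := Real.log_le_log (by positivity) h3
  rw [Real.log_div hn.ne' hd'.ne'] at h4
  rw [one_sub_div hpos.ne']
  gcongr
  push_cast at h2 h4
  linarith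

theorem tendsto_nat_div_div {d : ℕ} (hd : 0 < d) :
    Tendsto (fun n : ℕ+ => (((n : ℕ) / d : ℕ) : ℝ) / n) atTop (𝓝 (1 / d)) := by
  have h := (tendsto_nat_floor_mul_div_atTop (R := ℝ) (a := 1 / d) (by positivity)).comp
    (tendsto_natCast_atTop_atTop.comp tendsto_PNat_val_atTop_atTop)
  refine h.congr fun n => ?_
  simp only [Function.comp_apply]
  rw [one_div_mul_eq_div, Nat.floor_div_eq_div]

theorem isEKDistribution_harmonicPMF : IsEKDistribution harmonicPMF 1 1 where
  support_subset n i hi := by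
    by_contra h
    exact (PMF.mem_support_iff _ _).1 hi
      (PMF.ofFinset_apply_of_notMem _ _ (by rwa [Finset.mem_Icc]))
  large_primes n _ p hp _ := sum_deviation_le_one_div n hp.pos
  small_primes n _ k p _ hp _ :=
    sum_deviation_le_one_div_self n (Finset.prod_pos fun j _ => (hp j).pos)
  tendsto_zero p hp := by
    simp only [sum_deviation_harmonicPMF _ hp.pos]
    have h := ((tendsto_harmonic_div_ratio hp.pos).div_const (p : ℝ)).sub
      (tendsto_nat_div_div hp.pos)
    rw [sub_self] at h
    refine h.congr fun n => ?_
    rw [div_div, mul_comm (harmonicNumber n)]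

theorem mainTheorem2 :
    IsEKDistribution harmonicPMF 1 1 ∧
    ∀ x : ℝ, Filter.Tendsto
      (fun n : ℕ+ => (harmonicPMF n).toMeasure.real
        {m : ℕ | (ArithmeticFunction.cardDistinctFactors m : ℝ) - Real.log (Real.log (n : ℝ))
          ≤ x * Real.sqrt (Real.log (Real.log (n : ℝ)))})
      Filter.atTop
      (nhds ((ProbabilityTheory.gaussianReal 0 1).real (Set.Iic x))) :=
  ⟨isEKDistribution_harmonicPMF, harmonicPMF_erdos_kac⟩
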